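/- Let $\mathbb Z_{\ge 0}=\{0,1,2,\dots\}$ and let $\mathrm{Conf}(\mathbb Z_{\ge0})=2^{\mathbb Z_{\ge0}}$ be the space of all subsets of $\mathbb Z_{\ge 0}$ with the product topology (a compact, totally disconnected space). A probability measure $P$ on $\mathrm{Conf}(\mathbb Z_{\ge0})$ is called determinantal with correlation kernel $K$ if $$P\{X:\ x_1,\dots,x_k\in X\}=\det[K(x_i,x_j)]_{i,j=1}^k$$ for all $k$ and all pairwise distinct $x_1,\dots,x_k\in\mathbb Z_{\ge0}$. For a weight measure $W$ on $\mathbb R$ with all moments finite and infinite support, let $\widetilde P_0,\widetilde P_1,\dots$ be its orthonormal polynomials with positive leading coefficients, and for $r\in\mathbb R$ put $$K^+_{W,r}(x,y)=\int_{(r,+\infty)}\widetilde P_x\widetilde P_y\,dW,\qquad K^-_{W,r}(x,y)=\int_{(-\infty,r)}\widetilde P_x\widetilde P_y\,dW,\qquad x,y\in\mathbb Z_{\ge0}.$$ The discrete Hermite ensembles $\mathrm{DH}^\pm(r)$, $r\in\mathbb R$, are the determinantal measures with kernels $K^\pm_{W,r}$ for $W(dt)=e^{-t^2}dt$ on $\mathbb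 R$. The discrete Laguerre ensembles $\mathrm{DL}^\pm(r;\beta)$, $r>0$, $\beta>0$, are the determinantal measures with kernels $K^\pm_{W,r}$ for $W(dt)=t^{\beta-1}e^{-t}dt$ on $(0,+\infty)$. **Theorem.** These ensembles are well defined: for each of the kernels above with the indicated parameters there is exactly one determinantal measure with that correlation kernel. Fix $r\in\mathbb R$, and let $\beta\to+\infty$ and $\tilde r$ vary (along a sequence or, more generally, along any filter) in such a way that $$\frac{\beta-\tilde r}{\sqrt{2\beta}}\to -r .$$ Then $\mathrm{DL}^{+}(\tilde r;\beta)\to \mathrm{DH}^{+}(r)$ and $\mathrm{DL}^{-}(\tilde r;\beta)\to \mathrm{DH}^{-}(r)$ weakly, as probability measures on $\mathrm{Conf}(\mathbb Z_{\ge0})$. -/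

import Mathlib

open MeasureTheory Filter Topology

noncomputable section

/-- Point configurations in a discrete space `𝕏`: subsets of `𝕏`, encoded by their indicator
functions (`x` belongs to `c` iff `c x = true`). As a product of copies of the discrete two-point
space this carries the compact, totally disconnected topology in which the cylinder sets
`{c | Y ⊆ c}`, `Y` finite, are clopen and, with their complements, generate the topology; the
measurable structure is the corresponding product (Borel) one. -/
abbrev Conf (𝕏 : Type*) : Type _ := 𝕏 → Bool

/-- `P` is a determinantal measure on `Conf ℕ` with correlation kernel `K` (relative to the counting
measure): for pairwise distinct points `x₁, …, x_k`, the `k`-point correlation function, that is the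
probability that the random configuration contains all of them, equals `det [K(x_i, x_j)]`. -/
def IsDeterminantal (P : ProbabilityMeasure (Conf ℕ)) (K : ℕ → ℕ → ℝ) : Prop :=
  ∀ (k : ℕ) (x : Fin k → ℕ), Function.Injective x →
    (P : Measure (Conf ℕ)).real {c | ∀ i, c (x i) = true} =
      (Matrix.of fun i j => K (x i) (x j)).det

/-- The determinantal measure with correlation kernel `K` (an arbitrary probability measure if there
is none). -/
def determinantalMeasure (K : ℕ → ℕ → ℝ) : ProbabilityMeasure (Conf ℕ) :=
  Classical.epsilon fun P => IsDeterminantal P K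

/-- The monic orthogonal polynomials of a weight measure `W` on the real line (Gram–Schmidt
orthogonalization of `1, t, t², …` in `L²(ℝ, W)`). -/
def monicOrthoPoly (W : Measure ℝ) (n : ℕ) : Polynomial ℝ :=
  Polynomial.X ^ n - ∑ k : Fin n,
    Polynomial.C ((∫ t, t ^ n * (monicOrthoPoly W k).eval t ∂W) /
      ∫ t, (monicOrthoPoly W k).eval t ^ 2 ∂W) * monicOrthoPoly W k
termination_by n
decreasing_by all_goals exact k.isLt

/-- The orthonormal polynomials of `W`, with positive leading coefficients, as functions on `ℝ`. -/
def orthonormalPoly (W : Measure ℝ) (n : ℕ) (t : ℝ) : ℝ :=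
  (monicOrthoPoly W n).eval t / √(∫ s, (monicOrthoPoly W n).eval s ^ 2 ∂W)

/-- The discrete kernel `K⁺_r(x,y)` associated with the orthogonal polynomials of `W`: the matrix, in
the orthonormal polynomials, of the projection onto functions supported by `(r, +∞)`. -/
def discreteKernelPlus (W : Measure ℝ) (r : ℝ) (x y : ℕ) : ℝ :=
  ∫ t in Set.Ioi r, orthonormalPoly W x t * orthonormalPoly W y t ∂W

/-- The discrete kernel `K⁻_r(x,y)` associated with the orthogonal polynomials of `W`: the matrix, in
the orthonormal polynomials, of the projection onto functions supported by `(-∞, r)`. -/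
def discreteKernelMinus (W : Measure ℝ) (r : ℝ) (x y : ℕ) : ℝ :=
  ∫ t in Set.Iio r, orthonormalPoly W x t * orthonormalPoly W y t ∂W

/-- The Hermite weight measure `e^{-t²} dt` on `ℝ`. -/
def hermiteWeight : Measure ℝ :=
  volume.withDensity fun t => ENNReal.ofReal (Real.exp (-t ^ 2))

/-- The Laguerre weight measure `t^{β-1} e^{-t} dt` on `(0, +∞)`, for `β > 0`. -/
def laguerreWeight (β : ℝ) : Measure ℝ :=
  (volume.restrict (Set.Ioi 0)).withDensity fun t => ENNReal.ofReal (t ^ (β - 1) * Real.exp (-t))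

/-- The discrete Hermite ensemble `DH⁺(r)`, `r ∈ ℝ`. -/
def DHplus (r : ℝ) : ProbabilityMeasure (Conf ℕ) :=
  determinantalMeasure (discreteKernelPlus hermiteWeight r)

/-- The discrete Hermite ensemble `DH⁻(r)`, `r ∈ ℝ`. -/
def DHminus (r : ℝ) : ProbabilityMeasure (Conf ℕ) :=
  determinantalMeasure (discreteKernelMinus hermiteWeight r)

/-- The discrete Laguerre ensemble `DL⁺(r; β)`, `r > 0`, `β > 0`. -/
def DLplus (r β : ℝ) : ProbabilityMeasure (Conf ℕ) :=
  determinantalMeasure (discreteKernelPlus (laguerreWeight β) r)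

/-- The discrete Laguerre ensemble `DL⁻(r; β)`, `r > 0`, `β > 0`. -/
def DLminus (r β : ℝ) : ProbabilityMeasure (Conf ℕ) :=
  determinantalMeasure (discreteKernelMinus (laguerreWeight β) r)

end

section LinearAlgebra

variable {n : Type*} [DecidableEq n]

/-- The matrix with the rows of `K` in the positions in `A` and those of `L` elsewhere. -/
def mixedRows (A : Finset n) (K L : Matrix n n ℝ) : Matrix n n ℝ :=
  Matrix.of fun i => if i ∈ A then K i else L i

theorem mixedRows_of_mem {A : Finset n} {K L : Matrix n n ℝ} {i : n} (hi : i ∈ A) (j : n) :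
    mixedRows A K L i j = K i j := by
  simp [mixedRows, hi]

theorem mixedRows_of_notMem {A : Finset n} {K L : Matrix n n ℝ} {i : n} (hi : i ∉ A) (j : n) :
    mixedRows A K L i j = L i j := by
  simp [mixedRows, hi]

variable [Fintype n]

theorem det_fromBlocks_nonneg {m : Type*} [Fintype m] [DecidableEq m] {A : Matrix n n ℝ}
    {D : Matrix m m ℝ} (hA : A.PosDef) (hD : D.PosSemidef) (B : Matrix n m ℝ) :
    0 ≤ (Matrix.fromBlocks A B (-B.conjTranspose) D).det := by
  have hinv := hA.isUnit.invertible
  rw [Matrix.det_fromBlocks₁₁, Matrix.neg_mul, Matrix.neg_mul, sub_neg_eq_add,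
    Matrix.invOf_eq_nonsing_inv]
  exact mul_nonneg hA.det_pos.le
    (hD.add (hA.inv.posSemidef.conjTranspose_mul_mul_same B)).det_nonneg

theorem det_mixedRows_nonneg_of_posDef {K : Matrix n n ℝ} (hK : K.PosDef)
    (hK' : (1 - K).PosSemidef) (A : Finset n) (p : n → Prop)
    [DecidablePred p] (hp : ∀ i, p i ↔ i ∈ A) : 0 ≤ (mixedRows A K (1 - K)).det := by
  rw [Matrix.det_toBlock _ (p)]
  have h11 : (Matrix.toBlock (mixedRows A K (1 - K)) (p)
      p) = K.submatrix Subtype.val Subtype.val := by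
    ext i j; exact mixedRows_of_mem ((hp _).1 i.2) _
  have h12 : (Matrix.toBlock (mixedRows A K (1 - K)) (p)
      fun i => ¬ p i) = K.submatrix Subtype.val Subtype.val := by
    ext i j; exact mixedRows_of_mem ((hp _).1 i.2) _
  have h21 : (Matrix.toBlock (mixedRows A K (1 - K)) (fun i => ¬ p i)
      p) = -(K.submatrix Subtype.val Subtype.val) := by
    ext i j
    have : (i : n) ≠ j := fun h => i.2 (h ▸ j.2)
    simp [Matrix.toBlock, mixedRows_of_notMem (mt (hp _).2 i.2), Matrix.one_apply_ne this]
  have h22 : (Matrix.toBlock (mixedRows A K (1 - K)) (fun i => ¬ p i)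
      fun i => ¬ p i) = (1 - K).submatrix Subtype.val Subtype.val := by
    ext i j; exact mixedRows_of_notMem (mt (hp _).2 i.2) _
  rw [h11, h12, h21, h22]
  have hA : (K.submatrix (Subtype.val : {i // p i} → n) Subtype.val).PosDef :=
    hK.submatrix Subtype.val_injective
  have hD : ((1 - K).submatrix (Subtype.val : {i // ¬ p i} → n) Subtype.val).PosSemidef :=
    hK'.submatrix _
  have hs : (K.submatrix (Subtype.val : {i // p i} → n)
      (Subtype.val : {i // ¬ p i} → n)).conjTranspose = K.submatrix Subtype.val Subtype.val := by
    rw [Matrix.conjTranspose_submatrix, hK.isHermitian.eq]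
  rw [← hs]
  exact det_fromBlocks_nonneg hA hD _

theorem det_mixedRows_nonneg {K : Matrix n n ℝ} (hK : K.PosSemidef)
    (hK' : (1 - K).PosSemidef) (A : Finset n) : 0 ≤ (mixedRows A K (1 - K)).det := by
  let L : ℝ → Matrix n n ℝ := fun ε => (1 - ε) • K + ε • (1 : Matrix n n ℝ)
  have hc : Continuous fun ε => (mixedRows A (L ε) (1 - L ε)).det := by
    refine Continuous.matrix_det (continuous_pi fun i => continuous_pi fun j => ?_)
    by_cases hi : i ∈ A
    · simp only [mixedRows_of_mem hi, L, Matrix.add_apply, Matrix.smul_apply]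
      fun_prop
    · simp only [mixedRows_of_notMem hi, L, Matrix.add_apply, Matrix.smul_apply, Matrix.sub_apply]
      fun_prop
  have h0 : L 0 = K := by simp [L]
  have ht := hc.continuousAt (x := 0)
  rw [ContinuousAt, h0] at ht
  refine ge_of_tendsto (ht.mono_left (nhdsWithin_le_nhds (s := Set.Ioi 0))) ?_
  filter_upwards [Ioo_mem_nhdsGT (zero_lt_one (α := ℝ))] with ε hε
  refine det_mixedRows_nonneg_of_posDef ?_ ?_ A _ fun i => Iff.rfl
  · exact (Matrix.PosDef.one.smul hε.1).posSemidef_add (hK.smul (by linarith [hε.2]))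
  · have : 1 - L ε = (1 - ε) • (1 - K) := by
      simp only [L, smul_sub, sub_smul, one_smul]; abel
    rw [this]
    exact hK'.smul (by linarith [hε.2])

theorem sum_det_mixedRows (K : Matrix n n ℝ) (Y : Finset n) (p : n → Prop) [DecidablePred p]
    (hp : ∀ i, p i ↔ i ∈ Y) :
    ∑ A : Finset n with Y ⊆ A, (mixedRows A K (1 - K)).det =
      (K.submatrix (Subtype.val : {i // p i} → n) Subtype.val).det := by
  have h := (Matrix.detRowAlternating (n := n) (R := ℝ)).toMultilinearMap.map_add_univ K
    (mixedRows Y 0 (1 - K))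
  have h2 : ∀ A : Finset n, Matrix.detRowAlternating (A.piecewise K (mixedRows Y 0 (1 - K))) =
      if Y ⊆ A then (mixedRows A K (1 - K)).det else 0 := by
    intro A
    change (mixedRows A K (mixedRows Y 0 (1 - K))).det = _
    split_ifs with hY
    · congr 1
      ext i j
      by_cases hi : i ∈ A
      · simp only [mixedRows_of_mem hi]
      · have : i ∉ Y := fun h => hi (hY h)
        simp only [mixedRows_of_notMem hi, mixedRows_of_notMem this]
    · obtain ⟨i, hi, hiA⟩ := Finset.not_subset.mp hY
      refine Matrix.det_eq_zero_of_row_eq_zero i fun j => ?_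
      rw [mixedRows_of_notMem hiA, mixedRows_of_mem hi, Matrix.zero_apply]
  rw [Finset.sum_filter]
  simp_rw [← h2]
  refine h.symm.trans ?_
  change Matrix.det (K + mixedRows Y 0 (1 - K)) = _
  rw [Matrix.twoBlockTriangular_det _ p]
  · have h3 : Matrix.toSquareBlockProp (K + mixedRows Y 0 (1 - K)) (fun i => ¬ p i) = 1 := by
      ext i j
      simp [Matrix.toSquareBlockProp_def, mixedRows_of_notMem (mt (hp _).2 i.2), Matrix.one_apply,
        Subtype.ext_iff]
    rw [h3, Matrix.det_one, mul_one]
    congr 1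
    ext i j
    simp [Matrix.toSquareBlockProp_def, mixedRows_of_mem ((hp _).1 i.2)]
  · intro i hi j hj
    have : i ≠ j := fun h => hi (h ▸ hj)
    simp [mixedRows_of_notMem (mt (hp _).2 hi), Matrix.one_apply_ne this]

end LinearAlgebra

section Determinantal

theorem isClopen_setOf_forall_eq_true {k : ℕ} (x : Fin k → ℕ) :
    IsClopen {c : Conf ℕ | ∀ i, c (x i) = true} := by
  rw [Set.ofPred_forall]
  refine isClopen_iInter_of_finite fun i => ?_
  exact (isClopen_discrete {true}).preimage (continuous_apply (x i))

theorem measurableSpace_conf_eq_generateFrom :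
    (inferInstance : MeasurableSpace (Conf ℕ)) =
      MeasurableSpace.generateFrom
        (Set.range fun Y : Finset ℕ => {c : Conf ℕ | ∀ x ∈ Y, c x = true}) := by
  apply le_antisymm
  · refine iSup_le fun i => ?_
    rw [← measurable_iff_comap_le]
    refine @measurable_to_bool _ (_) _ (MeasurableSpace.measurableSet_generateFrom ⟨{i}, ?_⟩)
    ext c; simp
  · refine MeasurableSpace.generateFrom_le ?_
    rintro _ ⟨Y, rfl⟩
    have : {c : Conf ℕ | ∀ x ∈ Y, c x = true} = ⋂ x ∈ Y, {c : Conf ℕ | c x = true} := by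
      ext c; simp
    change MeasurableSet {c : Conf ℕ | ∀ x ∈ Y, c x = true}
    rw [this]
    exact Finset.measurableSet_biInter _ fun x _ =>
      (measurableSet_singleton true).preimage (measurable_pi_apply x)

theorem IsDeterminantal.unique {P Q : ProbabilityMeasure (Conf ℕ)} {K : ℕ → ℕ → ℝ}
    (hP : IsDeterminantal P K) (hQ : IsDeterminantal Q K) : P = Q := by
  apply Subtype.ext
  refine ext_of_generate_finite (μ := (P : Measure (Conf ℕ))) (ν := (Q : Measure (Conf ℕ))) _
    measurableSpace_conf_eq_generateFrom ?_ ?_ (by simp)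
  · rintro _ ⟨Y, rfl⟩ _ ⟨Z, rfl⟩ -
    refine ⟨Y ∪ Z, ?_⟩
    ext c
    simp only [Finset.mem_union, Set.mem_ofPred_eq, Set.mem_inter_iff]
    grind
  · rintro _ ⟨Y, rfl⟩
    have hx : Function.Injective fun i : Fin Y.card => (Y.equivFin.symm i : ℕ) :=
      Subtype.val_injective.comp Y.equivFin.symm.injective
    have hs : {c : Conf ℕ | ∀ x ∈ Y, c x = true} =
        {c : Conf ℕ | ∀ i : Fin Y.card, c (Y.equivFin.symm i : ℕ) = true} := by
      ext c
      refine ⟨fun h i => h _ (Y.equivFin.symm i).2, fun h x hxY => ?_⟩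
      simpa using h (Y.equivFin ⟨x, hxY⟩)
    have := (hP _ _ hx).trans (hQ _ _ hx).symm
    rw [← hs] at this
    exact (measureReal_eq_measureReal_iff).1 this

theorem tendsto_measureReal_setOf_forall {ι : Type*} {l : Filter ι}
    {P : ι → ProbabilityMeasure (Conf ℕ)} {Q : ProbabilityMeasure (Conf ℕ)}
    (h : Tendsto P l (𝓝 Q)) {k : ℕ} (x : Fin k → ℕ) :
    Tendsto (fun i => (P i : Measure (Conf ℕ)).real {c | ∀ j, c (x j) = true}) l
      (𝓝 ((Q : Measure (Conf ℕ)).real {c | ∀ j, c (x j) = true})) :=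
  (NNReal.continuous_coe.tendsto _).comp
    (ProbabilityMeasure.tendsto_measure_of_isClopen_of_tendsto h (isClopen_setOf_forall_eq_true x))

/-- If the correlation functions of `P i` converge along an ultrafilter to the determinants of
`K`, then `P i` converges weakly to a determinantal measure with kernel `K`. -/
theorem exists_isDeterminantal_tendsto {ι : Type*} (l : Ultrafilter ι)
    {P : ι → ProbabilityMeasure (Conf ℕ)} {K : ℕ → ℕ → ℝ}
    (h : ∀ (k : ℕ) (x : Fin k → ℕ), Function.Injective x →
      Tendsto (fun i => (P i : Measure (Conf ℕ)).real {c | ∀ j, c (x j) = true}) l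
        (𝓝 (Matrix.of fun i j => K (x i) (x j)).det)) :
    ∃ Q, IsDeterminantal Q K ∧ Tendsto P l (𝓝 Q) := by
  obtain ⟨Q, -, hQ⟩ := isCompact_univ.ultrafilter_le_nhds (l.map P) (by simp)
  exact ⟨Q, fun k x hx => tendsto_nhds_unique (tendsto_measureReal_setOf_forall hQ x) (h k x hx),
    hQ⟩

/-- Convergence of kernels implies weak convergence of determinantal measures. -/
theorem IsDeterminantal.tendsto {ι : Type*} {l : Filter ι}
    {P : ι → ProbabilityMeasure (Conf ℕ)} {Q : ProbabilityMeasure (Conf ℕ)}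
    {K : ι → ℕ → ℕ → ℝ} {L : ℕ → ℕ → ℝ} (hP : ∀ᶠ i in l, IsDeterminantal (P i) (K i))
    (hQ : IsDeterminantal Q L) (h : ∀ x y, Tendsto (fun i => K i x y) l (𝓝 (L x y))) :
    Tendsto P l (𝓝 Q) := by
  rw [tendsto_iff_ultrafilter]
  intro u hu
  obtain ⟨Q', hQ', hlim⟩ := exists_isDeterminantal_tendsto u (P := P) (K := L) fun k x hx => by
    have hdet : Tendsto (fun i => (Matrix.of fun a b => K i (x a) (x b)).det) l
        (𝓝 (Matrix.of fun a b => L (x a) (x b)).det) :=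
      ((continuous_id.matrix_det).tendsto (Matrix.of fun a b => L (x a) (x b))).comp
        (tendsto_pi_nhds.2 fun a => tendsto_pi_nhds.2 fun b => h (x a) (x b))
    refine (hdet.congr' ?_).mono_left hu
    filter_upwards [hP] with i hi
    exact (hi k x hx).symm
  rwa [hQ.unique hQ']

/-- The configuration on `ℕ` with the point set `A`. -/
def finConf {n : ℕ} (A : Finset (Fin n)) : Conf ℕ := fun x => decide (∃ i ∈ A, (i : ℕ) = x)

theorem finConf_eq_true_iff {n : ℕ} (A : Finset (Fin n)) (i : Fin n) :
    finConf A i = true ↔ i ∈ A := by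
  simp [finConf, Fin.val_inj]

theorem exists_probabilityMeasure_fin {n : ℕ} {K : Matrix (Fin n) (Fin n) ℝ}
    (hK : K.PosSemidef) (hK' : (1 - K).PosSemidef) :
    ∃ P : ProbabilityMeasure (Conf ℕ), ∀ (k : ℕ) (x : Fin k → Fin n), Function.Injective x →
      (P : Measure (Conf ℕ)).real {c | ∀ i, c (x i) = true} = (K.submatrix x x).det := by
  classical
  let μ : Measure (Conf ℕ) := ∑ A : Finset (Fin n),
    ENNReal.ofReal (mixedRows A K (1 - K)).det • Measure.dirac (finConf A)
  have key : ∀ (k : ℕ) (x : Fin k → Fin n), Function.Injective x →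
      μ {c | ∀ i, c (x i) = true} = ENNReal.ofReal (K.submatrix x x).det := by
    intro k x hx
    have hm := (isClopen_setOf_forall_eq_true fun i => (x i : ℕ)).isOpen.measurableSet
    have h1 := sum_det_mixedRows K (Finset.univ.image x) (· ∈ Set.range x) (by simp)
    have h2 : (K.submatrix x x).det =
        ∑ A : Finset (Fin n) with Finset.univ.image x ⊆ A, (mixedRows A K (1 - K)).det := by
      rw [h1]
      convert (Matrix.det_submatrix_equiv_self (Equiv.ofInjective x hx)
        (K.submatrix Subtype.val Subtype.val)) using 1
      · rfl
      · congr!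
    rw [h2, ENNReal.ofReal_sum_of_nonneg fun A _ => det_mixedRows_nonneg hK hK' A,
      Finset.sum_filter]
    simp only [μ, Measure.coe_finsetSum, Finset.sum_apply, Measure.smul_apply, smul_eq_mul]
    refine Finset.sum_congr rfl fun A _ => ?_
    rw [Measure.dirac_apply' _ hm]
    have : finConf A ∈ {c : Conf ℕ | ∀ i, c (x i) = true} ↔ Finset.univ.image x ⊆ A := by
      simp [finConf_eq_true_iff, Finset.subset_iff]
    by_cases h : Finset.univ.image x ⊆ A
    · rw [if_pos h, Set.indicator_of_mem (this.2 h)]; simp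
    · rw [if_neg h, Set.indicator_of_notMem (mt this.1 h)]; simp
  have hμ : IsProbabilityMeasure μ := ⟨by
    have := key 0 Fin.elim0 (fun i => i.elim0)
    simpa using this⟩
  refine ⟨⟨μ, hμ⟩, fun k x hx => ?_⟩
  have := key k x hx
  simp only [ProbabilityMeasure.coe_mk, measureReal_def, this]
  rw [ENNReal.toReal_ofReal (hK.submatrix x).det_nonneg]

/-- **Existence and uniqueness of determinantal measures** with a real symmetric kernel `K`
such that `0 ≤ K ≤ 1`. -/
theorem existsUnique_isDeterminantal {K : ℕ → ℕ → ℝ}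
    (hK : ∀ n, (Matrix.of fun i j : Fin n => K i j).PosSemidef)
    (hK' : ∀ n, (1 - Matrix.of fun i j : Fin n => K i j).PosSemidef) :
    ∃! P, IsDeterminantal P K := by
  choose P hP using fun n => exists_probabilityMeasure_fin (hK n) (hK' n)
  have hlim : ∀ (k : ℕ) (x : Fin k → ℕ), Function.Injective x →
      Tendsto (fun n => (P n : Measure (Conf ℕ)).real {c | ∀ j, c (x j) = true}) (hyperfilter ℕ)
        (𝓝 (Matrix.of fun i j => K (x i) (x j)).det) := by
    intro k x hx
    refine tendsto_const_nhds.congr' ?_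
    have hev : ∀ᶠ n in atTop, ∀ i, x i < n := eventually_all.2 fun i => eventually_gt_atTop (x i)
    refine (hev.filter_mono Nat.hyperfilter_le_atTop).mono fun n hn => ?_
    exact (hP n k (fun i => ⟨x i, hn i⟩) fun i j h => hx (congrArg Fin.val h)).symm
  obtain ⟨Q, hQ, -⟩ := exists_isDeterminantal_tendsto (hyperfilter ℕ) hlim
  exact ⟨Q, hQ, fun Q' hQ' => hQ'.unique hQ⟩

theorem isDeterminantal_determinantalMeasure {K : ℕ → ℕ → ℝ}
    (h : ∃ P, IsDeterminantal P K) : IsDeterminantal (determinantalMeasure K) K :=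
  Classical.epsilon_spec h

end Determinantal

section OrthogonalPolynomials

open Polynomial

/-- A weight measure on the real line: all polynomials are integrable, and the squares of
nonzero ones have positive integral (that is, the support is infinite). -/
structure IsPolyWeight (W : Measure ℝ) : Prop where
  integrable : ∀ p : ℝ[X], Integrable (fun t => p.eval t) W
  pos : ∀ p : ℝ[X], p ≠ 0 → 0 < ∫ t, p.eval t ^ 2 ∂W

theorem monicOrthoPoly_eq (W : Measure ℝ) (n : ℕ) : monicOrthoPoly W n =
    X ^ n - ∑ k : Fin n, C ((∫ t, t ^ n * (monicOrthoPoly W k).eval t ∂W) /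
      ∫ t, (monicOrthoPoly W k).eval t ^ 2 ∂W) * monicOrthoPoly W k := by
  rw [monicOrthoPoly]

theorem monicOrthoPoly_monic_degree (W : Measure ℝ) (n : ℕ) :
    (monicOrthoPoly W n).Monic ∧ (monicOrthoPoly W n).degree = n := by
  induction n using Nat.strong_induction_on with
  | _ n ih =>
    have hlt : (∑ k : Fin n, C ((∫ t, t ^ n * (monicOrthoPoly W k).eval t ∂W) /
        ∫ t, (monicOrthoPoly W k).eval t ^ 2 ∂W) * monicOrthoPoly W k).degree <
        (X ^ n : ℝ[X]).degree := by
      rw [degree_X_pow]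
      refine (degree_sum_le _ _).trans_lt ((Finset.sup_lt_iff (WithBot.bot_lt_coe n)).2 ?_)
      intro k _
      rw [← smul_eq_C_mul]
      refine (degree_smul_le _ _).trans_lt ?_
      rw [(ih k k.2).2]
      exact Nat.cast_lt.2 k.2
    rw [monicOrthoPoly_eq]
    exact ⟨(monic_X_pow n).sub_of_left hlt,
      (degree_sub_eq_left_of_degree_lt hlt).trans (degree_X_pow n)⟩

theorem monicOrthoPoly_monic (W : Measure ℝ) (n : ℕ) : (monicOrthoPoly W n).Monic :=
  (monicOrthoPoly_monic_degree W n).1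

theorem monicOrthoPoly_degree (W : Measure ℝ) (n : ℕ) : (monicOrthoPoly W n).degree = n :=
  (monicOrthoPoly_monic_degree W n).2

/-- The moment functional `p ↦ ∫ p dW` of a weight. -/
noncomputable def IsPolyWeight.functional {W : Measure ℝ} (hW : IsPolyWeight W) : ℝ[X] →ₗ[ℝ] ℝ where
  toFun p := ∫ t, p.eval t ∂W
  map_add' p q := by
    simp only [eval_add]
    exact integral_add (hW.integrable p) (hW.integrable q)
  map_smul' c p := by
    simp only [eval_smul, smul_eq_mul, RingHom.id_apply]
    exact integral_const_mul c _

namespace IsPolyWeight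

variable {W : Measure ℝ}

theorem functional_apply (hW : IsPolyWeight W) (p : ℝ[X]) : hW.functional p = ∫ t, p.eval t ∂W :=
  rfl

theorem functional_mul_self_pos (hW : IsPolyWeight W) {p : ℝ[X]} (hp : p ≠ 0) :
    0 < hW.functional (p * p) := by
  have := hW.pos p hp
  simpa only [functional_apply, ← sq, eval_pow] using this

theorem functional_C_mul (hW : IsPolyWeight W) (c : ℝ) (p : ℝ[X]) :
    hW.functional (C c * p) = c * hW.functional p := by
  rw [← smul_eq_C_mul, map_smul, smul_eq_mul]

theorem functional_monicOrthoPoly_mul (hW : IsPolyWeight W) (n : ℕ) :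
    ∀ k < n, hW.functional (monicOrthoPoly W n * monicOrthoPoly W k) = 0 := by
  induction n using Nat.strong_induction_on with
  | _ n ih =>
    intro j hj
    rw [monicOrthoPoly_eq W n, sub_mul, map_sub, Finset.sum_mul, map_sum,
      Finset.sum_eq_single (⟨j, hj⟩ : Fin n)]
    · rw [mul_assoc, hW.functional_C_mul]
      have h1 : ∫ t, t ^ n * (monicOrthoPoly W j).eval t ∂W =
          hW.functional (X ^ n * monicOrthoPoly W j) := by
        simp [functional_apply]
      have h2 : ∫ t, (monicOrthoPoly W j).eval t ^ 2 ∂W =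
          hW.functional (monicOrthoPoly W j * monicOrthoPoly W j) := by
        simp [functional_apply, sq]
      rw [h1, h2, div_mul_cancel₀, sub_self]
      exact (hW.functional_mul_self_pos (monicOrthoPoly_monic W j).ne_zero).ne'
    · intro k _ hk
      have hkj : (k : ℕ) ≠ j := fun h => hk (Fin.ext h)
      rw [mul_assoc, hW.functional_C_mul]
      rcases lt_or_gt_of_ne hkj with h | h
      · rw [mul_comm (monicOrthoPoly W k), ih j hj k h, mul_zero]
      · rw [ih k k.2 j h, mul_zero]
    · simp

theorem functional_monicOrthoPoly_mul_eq_zero (hW : IsPolyWeight W) {n : ℕ} {q : ℝ[X]}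
    (hq : q.degree < n) :
    hW.functional (monicOrthoPoly W n * q) = 0 := by
  suffices ∀ m ≤ n, ∀ q : ℝ[X], q.degree < m → hW.functional (monicOrthoPoly W n * q) = 0 from
    this n le_rfl q hq
  intro m
  induction m with
  | zero =>
    intro _ q hq
    have : q = 0 := by simpa using hq
    simp [this]
  | succ m ih =>
    intro hm q hq
    have hlt : (q - C (q.coeff m) * monicOrthoPoly W m).degree < m := by
      rw [degree_lt_iff_coeff_zero]
      intro i hi
      rw [coeff_sub, coeff_C_mul]
      rcases hi.eq_or_lt with rfl | hi
      · have h1 : (monicOrthoPoly W m).natDegree = m :=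
          natDegree_eq_of_degree_eq_some (monicOrthoPoly_degree W m)
        have h2 := (monicOrthoPoly_monic W m).coeff_natDegree
        rw [h1] at h2
        simp [h2]
      · rw [(degree_lt_iff_coeff_zero _ _).1 hq i hi,
          coeff_eq_zero_of_degree_lt (p := monicOrthoPoly W m)
            (by rw [monicOrthoPoly_degree]; exact_mod_cast hi)]
        simp
    have h := ih (by omega) _ hlt
    rw [mul_sub, map_sub, mul_left_comm, hW.functional_C_mul,
      hW.functional_monicOrthoPoly_mul n m (by omega), mul_zero, sub_zero] at h
    exact h

theorem eq_monicOrthoPoly (hW : IsPolyWeight W) {n : ℕ} {p : ℝ[X]} (hp : p.Monic)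
    (hd : p.degree = n)
    (ho : ∀ q : ℝ[X], q.degree < n → hW.functional (p * q) = 0) : p = monicOrthoPoly W n := by
  by_contra hne
  have hlt : (p - monicOrthoPoly W n).degree < n := by
    rw [← hd]
    exact degree_sub_lt_left (by rw [hd, monicOrthoPoly_degree]) hp.ne_zero
      (by rw [hp.leadingCoeff, (monicOrthoPoly_monic W n).leadingCoeff])
  have h := hW.functional_mul_self_pos (sub_ne_zero.2 hne)
  rw [sub_mul, map_sub, ho _ hlt, hW.functional_monicOrthoPoly_mul_eq_zero hlt] at h
  simp at h

theorem integral_monicOrthoPoly_sq_pos (hW : IsPolyWeight W) (n : ℕ) :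
    0 < ∫ t, (monicOrthoPoly W n).eval t ^ 2 ∂W :=
  hW.pos _ (monicOrthoPoly_monic W n).ne_zero

theorem orthonormalPoly_mul_eq (x y : ℕ) (t : ℝ) :
    orthonormalPoly W x t * orthonormalPoly W y t =
      (monicOrthoPoly W x * monicOrthoPoly W y).eval t *
        (√(∫ s, (monicOrthoPoly W x).eval s ^ 2 ∂W) *
          √(∫ s, (monicOrthoPoly W y).eval s ^ 2 ∂W))⁻¹ := by
  rw [orthonormalPoly, orthonormalPoly, eval_mul, div_mul_div_comm, div_eq_mul_inv]

theorem integrable_orthonormalPoly_mul (hW : IsPolyWeight W) (x y : ℕ) :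
    Integrable (fun t => orthonormalPoly W x t * orthonormalPoly W y t) W := by
  simp_rw [orthonormalPoly_mul_eq]
  exact (hW.integrable _).mul_const _

theorem integral_orthonormalPoly_mul (hW : IsPolyWeight W) (x y : ℕ) :
    ∫ t, orthonormalPoly W x t * orthonormalPoly W y t ∂W = if x = y then 1 else 0 := by
  simp_rw [orthonormalPoly_mul_eq]
  rw [integral_mul_const, ← hW.functional_apply]
  split_ifs with h
  · subst h
    have h2 : ∫ t, (monicOrthoPoly W x).eval t ^ 2 ∂W =
        hW.functional (monicOrthoPoly W x * monicOrthoPoly W x) := by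
      simp [functional_apply, sq]
    rw [Real.mul_self_sqrt (hW.integral_monicOrthoPoly_sq_pos x).le, h2]
    exact mul_inv_cancel₀ (hW.functional_mul_self_pos (monicOrthoPoly_monic W x).ne_zero).ne'
  · rcases lt_or_gt_of_ne h with h | h
    · rw [mul_comm (monicOrthoPoly W x), hW.functional_monicOrthoPoly_mul y x h, zero_mul]
    · rw [hW.functional_monicOrthoPoly_mul x y h, zero_mul]

end IsPolyWeight

/-- The matrix, in the orthonormal polynomials of `W`, of the projection onto functions
supported by `S`. -/
noncomputable def discreteKernelOn (W : Measure ℝ) (S : Set ℝ) (x y : ℕ) : ℝ :=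
  ∫ t in S, orthonormalPoly W x t * orthonormalPoly W y t ∂W

namespace IsPolyWeight

variable {W : Measure ℝ}

theorem posSemidef_discreteKernelOn (hW : IsPolyWeight W) (S : Set ℝ) (n : ℕ) :
    (Matrix.of fun i j : Fin n => discreteKernelOn W S i j).PosSemidef := by
  refine Matrix.PosSemidef.of_dotProduct_mulVec_nonneg ?_ fun v => ?_
  · ext i j
    simp only [Matrix.conjTranspose_apply, Matrix.of_apply, star_trivial, discreteKernelOn]
    simp only [mul_comm]
  · have h : star v ⬝ᵥ (Matrix.of fun i j : Fin n => discreteKernelOn W S i j).mulVec v =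
        ∫ t in S, (∑ i, v i * orthonormalPoly W i t) ^ 2 ∂W := by
      simp_rw [sq, Finset.sum_mul_sum]
      rw [integral_finsetSum]
      · simp only [dotProduct, Matrix.mulVec, star_trivial, Finset.mul_sum]
        refine Finset.sum_congr rfl fun i _ => ?_
        rw [integral_finsetSum]
        · refine Finset.sum_congr rfl fun j _ => ?_
          rw [Matrix.of_apply, discreteKernelOn, ← integral_mul_const, ← integral_const_mul]
          congr 1; ext t; ring
        · intro j _
          refine (((hW.integrable_orthonormalPoly_mul i j).const_mul
            (v i * v j)).integrableOn).congr (Eventually.of_forall fun t => ?_)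
          ring
      · intro i _
        refine integrable_finsetSum _ fun j _ => ?_
        refine (((hW.integrable_orthonormalPoly_mul i j).const_mul
          (v i * v j)).integrableOn).congr (Eventually.of_forall fun t => ?_)
        ring
    rw [h]
    exact integral_nonneg fun t => sq_nonneg _

theorem one_sub_discreteKernelOn (hW : IsPolyWeight W) {S : Set ℝ} (hS : MeasurableSet S) (n : ℕ) :
    (1 - Matrix.of fun i j : Fin n => discreteKernelOn W S i j) =
      Matrix.of fun i j : Fin n => discreteKernelOn W Sᶜ i j := by
  ext i j
  have h := integral_add_compl hS (hW.integrable_orthonormalPoly_mul i j)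
  rw [hW.integral_orthonormalPoly_mul] at h
  simp only [Matrix.sub_apply, Matrix.of_apply, Matrix.one_apply, discreteKernelOn, Fin.ext_iff]
  linarith

theorem existsUnique_isDeterminantal (hW : IsPolyWeight W) {S : Set ℝ} (hS : MeasurableSet S) :
    ∃! P, IsDeterminantal P (discreteKernelOn W S) :=
  _root_.existsUnique_isDeterminantal (hW.posSemidef_discreteKernelOn S) fun n => by
    rw [hW.one_sub_discreteKernelOn hS]
    exact hW.posSemidef_discreteKernelOn Sᶜ n

end IsPolyWeight

/-! ### Affine changes of variable -/

section Affine

variable {W W' : Measure ℝ} {a b c : ℝ}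

theorem monicOrthoPoly_eval_affine (hW : IsPolyWeight W) (hW' : IsPolyWeight W') (ha : 0 < a)
    (hc : 0 < c) (h : ∀ f : ℝ → ℝ, ∫ t, f t ∂W = c * ∫ s, f (a * s + b) ∂W') (n : ℕ) (s : ℝ) :
    (monicOrthoPoly W n).eval (a * s + b) = a ^ n * (monicOrthoPoly W' n).eval s := by
  have hl : (C a * X + C b : ℝ[X]).natDegree = 1 := natDegree_linear ha.ne'
  have hlc : (C a * X + C b : ℝ[X]).leadingCoeff = a := leadingCoeff_linear ha.ne'
  have hn : (monicOrthoPoly W n).natDegree = n :=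
    natDegree_eq_of_degree_eq_some (monicOrthoPoly_degree W n)
  have key : C (a ^ n)⁻¹ * (monicOrthoPoly W n).comp (C a * X + C b) = monicOrthoPoly W' n := by
    have hm : (C (a ^ n)⁻¹ * (monicOrthoPoly W n).comp (C a * X + C b)).Monic := by
      rw [Monic, leadingCoeff_mul, leadingCoeff_C, leadingCoeff_comp (by omega), hlc, hn,
        (monicOrthoPoly_monic W n).leadingCoeff, one_mul, inv_mul_cancel₀ (pow_ne_zero _ ha.ne')]
    refine hW'.eq_monicOrthoPoly hm ?_ fun q hq => ?_
    · rw [degree_eq_natDegree hm.ne_zero, natDegree_C_mul (inv_ne_zero (pow_ne_zero _ ha.ne')),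
        natDegree_comp, hl, hn, mul_one]
    · have hd : (q.comp (C a⁻¹ * X + C (-(b / a)))).degree < n := by
        by_cases hq0 : q = 0
        · simp [hq0]
        · refine degree_le_natDegree.trans_lt ?_
          rw [natDegree_comp, natDegree_linear (inv_ne_zero ha.ne'), mul_one]
          rwa [degree_eq_natDegree hq0] at hq
      have h0 := hW.functional_monicOrthoPoly_mul_eq_zero hd
      rw [hW.functional_apply, h] at h0
      have h1 := (mul_eq_zero.1 h0).resolve_left hc.ne'
      rw [mul_assoc, hW'.functional_C_mul, hW'.functional_apply]
      convert mul_zero _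
      rw [← h1]
      congr 1; ext s
      simp only [eval_mul, eval_comp, eval_add, eval_C, eval_X]
      congr 2
      field_simp
      ring
  rw [← key, eval_mul, eval_C, eval_comp, mul_inv_cancel_left₀ (pow_ne_zero _ ha.ne')]
  simp

theorem orthonormalPoly_affine (hW : IsPolyWeight W) (hW' : IsPolyWeight W') (ha : 0 < a)
    (hc : 0 < c) (h : ∀ f : ℝ → ℝ, ∫ t, f t ∂W = c * ∫ s, f (a * s + b) ∂W') (n : ℕ) (s : ℝ) :
    orthonormalPoly W n (a * s + b) = (√c)⁻¹ * orthonormalPoly W' n s := by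
  have hi : ∫ t, (monicOrthoPoly W n).eval t ^ 2 ∂W =
      c * ((a ^ n) ^ 2 * ∫ s, (monicOrthoPoly W' n).eval s ^ 2 ∂W') := by
    rw [h]
    simp_rw [monicOrthoPoly_eval_affine hW hW' ha hc h, mul_pow (a ^ n)]
    rw [integral_const_mul]
  rw [orthonormalPoly, orthonormalPoly, hi, monicOrthoPoly_eval_affine hW hW' ha hc h,
    Real.sqrt_mul hc.le, Real.sqrt_mul (sq_nonneg _), Real.sqrt_sq (pow_nonneg ha.le n)]
  have := pow_ne_zero n ha.ne'
  field_simp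

theorem discreteKernelOn_affine (hW : IsPolyWeight W) (hW' : IsPolyWeight W') (ha : 0 < a)
    (hc : 0 < c) (h : ∀ f : ℝ → ℝ, ∫ t, f t ∂W = c * ∫ s, f (a * s + b) ∂W') {S : Set ℝ}
    (hS : MeasurableSet S) (x y : ℕ) :
    discreteKernelOn W S x y = discreteKernelOn W' ((fun s => a * s + b) ⁻¹' S) x y := by
  rw [discreteKernelOn, discreteKernelOn, ← integral_indicator hS, h, ← integral_const_mul,
    ← integral_indicator (hS.preimage (by fun_prop))]
  congr 1; ext s
  by_cases hs : a * s + b ∈ S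
  · rw [Set.indicator_of_mem hs, Set.indicator_of_mem (by exact hs),
      orthonormalPoly_affine hW hW' ha hc h, orthonormalPoly_affine hW hW' ha hc h]
    have : (√c)⁻¹ * (√c)⁻¹ = c⁻¹ := by rw [← mul_inv, Real.mul_self_sqrt hc.le]
    calc c * ((√c)⁻¹ * orthonormalPoly W' x s * ((√c)⁻¹ * orthonormalPoly W' y s))
        = c * ((√c)⁻¹ * (√c)⁻¹) * (orthonormalPoly W' x s * orthonormalPoly W' y s) := by ring
      _ = _ := by rw [this, mul_inv_cancel₀ hc.ne', one_mul]
  · rw [Set.indicator_of_notMem hs, Set.indicator_of_notMem (by exact hs), mul_zero]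

end Affine

end OrthogonalPolynomials

section Densities

open Polynomial

/-- The measure on the line with density `g`. -/
noncomputable def densityMeasure (g : ℝ → ℝ) : Measure ℝ :=
  volume.withDensity fun t => ENNReal.ofReal (g t)

theorem integral_densityMeasure {g : ℝ → ℝ} (hg : Measurable g) (h0 : ∀ t, 0 ≤ g t) (f : ℝ → ℝ) :
    ∫ t, f t ∂densityMeasure g = ∫ t, g t * f t := by
  rw [densityMeasure, integral_withDensity_eq_integral_toReal_smul hg.ennreal_ofReal
    (Eventually.of_forall fun t => ENNReal.ofReal_lt_top)]
  simp only [ENNReal.toReal_ofReal (h0 _), smul_eq_mul]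

theorem integrable_densityMeasure_iff {g : ℝ → ℝ} (hg : Measurable g) (h0 : ∀ t, 0 ≤ g t)
    {f : ℝ → ℝ} : Integrable f (densityMeasure g) ↔ Integrable fun t => g t * f t := by
  rw [densityMeasure, integrable_withDensity_iff_integrable_smul' hg.ennreal_ofReal
    (Eventually.of_forall fun t => ENNReal.ofReal_lt_top)]
  simp only [ENNReal.toReal_ofReal (h0 _), smul_eq_mul]

theorem isPolyWeight_densityMeasure {g : ℝ → ℝ} (hg : Measurable g) (h0 : ∀ t, 0 ≤ g t)
    {a : ℝ} (hpos : ∀ t, a < t → 0 < g t)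
    (hi : ∀ p : ℝ[X], Integrable fun t => g t * p.eval t) : IsPolyWeight (densityMeasure g) where
  integrable p := (integrable_densityMeasure_iff hg h0).2 (hi p)
  pos p hp := by
    rw [integral_densityMeasure hg h0]
    have hi2 : Integrable fun t => g t * p.eval t ^ 2 := by
      simpa only [sq, eval_mul] using hi (p * p)
    rw [integral_pos_iff_support_of_nonneg (fun t => mul_nonneg (h0 t) (sq_nonneg _)) hi2]
    have hsub : Set.Ioi a \ {t | p.IsRoot t} ⊆ Function.support fun t => g t * p.eval t ^ 2 := by
      rintro t ⟨ht, hr⟩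
      exact mul_ne_zero (hpos t ht).ne' (pow_ne_zero 2 hr)
    refine lt_of_lt_of_le ?_ (measure_mono hsub)
    rw [measure_sdiff_null ((finite_setOfPred_isRoot hp).measure_zero _)]
    simp

theorem one_add_abs_pow_mul_exp_le (m : ℕ) (t : ℝ) :
    (1 + |t|) ^ m * Real.exp (-|t| / 2) ≤
      (2 ^ (m + 2) * (m + 2).factorial * Real.exp (1 / 2)) * (1 + t ^ 2)⁻¹ := by
  have h1 : ((1 + |t|) / 2) ^ (m + 2) / (m + 2).factorial ≤ Real.exp ((1 + |t|) / 2) :=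
    Real.pow_div_factorial_le_exp _ (by positivity) _
  have h2 : 1 + t ^ 2 ≤ (1 + |t|) ^ 2 := by nlinarith [abs_nonneg t, sq_abs t]
  have h3 : (0 : ℝ) < 1 + t ^ 2 := by positivity
  have hf : (0 : ℝ) < (m + 2).factorial := by positivity
  rw [← div_eq_mul_inv, le_div_iff₀ h3]
  rw [div_le_iff₀ hf, div_pow, div_le_iff₀ (by positivity)] at h1
  calc (1 + |t|) ^ m * Real.exp (-|t| / 2) * (1 + t ^ 2)
      ≤ (1 + |t|) ^ m * Real.exp (-|t| / 2) * (1 + |t|) ^ 2 := by gcongr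
    _ = (1 + |t|) ^ (m + 2) * Real.exp (-|t| / 2) := by ring
    _ ≤ (Real.exp ((1 + |t|) / 2) * (m + 2).factorial * 2 ^ (m + 2)) * Real.exp (-|t| / 2) := by
        gcongr
    _ = 2 ^ (m + 2) * (m + 2).factorial *
          (Real.exp ((1 + |t|) / 2) * Real.exp (-|t| / 2)) := by ring
    _ = _ := by rw [← Real.exp_add]; congr 3; ring

theorem integrable_one_add_abs_pow_mul_exp (m : ℕ) :
    Integrable fun t : ℝ => (1 + |t|) ^ m * Real.exp (-|t| / 2) := by
  refine (integrable_inv_one_add_sq.const_mul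
    (2 ^ (m + 2) * (m + 2).factorial * Real.exp (1 / 2))).mono'
      (by fun_prop) (Eventually.of_forall fun t => ?_)
  rw [Real.norm_of_nonneg (by positivity)]
  exact one_add_abs_pow_mul_exp_le m t

theorem abs_pow_le_one_add_abs_pow (t : ℝ) (m : ℕ) : |t ^ m| ≤ (1 + |t|) ^ m := by
  rw [abs_pow]
  gcongr
  linarith

theorem exists_abs_eval_le (p : ℝ[X]) : ∃ C, 0 ≤ C ∧ ∃ m : ℕ, ∀ t, |p.eval t| ≤ C * (1 + |t|) ^ m := by
  refine ⟨∑ i ∈ Finset.range (p.natDegree + 1), |p.coeff i|, by positivity, p.natDegree,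
    fun t => ?_⟩
  rw [eval_eq_sum_range, Finset.sum_mul]
  refine (Finset.abs_sum_le_sum_abs _ _).trans (Finset.sum_le_sum fun i hi => ?_)
  rw [abs_mul]
  gcongr
  refine (abs_pow_le_one_add_abs_pow t i).trans (pow_le_pow_right₀ ?_ ?_)
  · linarith [abs_nonneg t]
  · exact Nat.lt_succ_iff.1 (Finset.mem_range.1 hi)

theorem integrable_mul_eval_of_le_exp {g : ℝ → ℝ} (hg : Measurable g) (h0 : ∀ t, 0 ≤ g t) {B : ℝ}
    (hB : ∀ t, g t ≤ B * Real.exp (-|t| / 2)) (p : ℝ[X]) :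
    Integrable fun t => g t * p.eval t := by
  obtain ⟨C, hC, m, hp⟩ := exists_abs_eval_le p
  refine ((integrable_one_add_abs_pow_mul_exp m).const_mul (B * C)).mono'
    (by fun_prop) (Eventually.of_forall fun t => ?_)
  rw [norm_mul, Real.norm_of_nonneg (h0 t), Real.norm_eq_abs]
  calc g t * |p.eval t| ≤ (B * Real.exp (-|t| / 2)) * (C * (1 + |t|) ^ m) :=
        mul_le_mul (hB t) (hp t) (abs_nonneg _) ((h0 t).trans (hB t))
    _ = _ := by ring

/-- Pointwise convergence of continuous functions with a uniform polynomial bound. -/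
structure TendstoPolyBounded {ι : Type*} (l : Filter ι) (f : ι → ℝ → ℝ) (f₀ : ℝ → ℝ) : Prop where
  continuous : ∀ i, Continuous (f i)
  tendsto : ∀ t, Tendsto (fun i => f i t) l (𝓝 (f₀ t))
  bound : ∃ C, 0 ≤ C ∧ ∃ m : ℕ, ∀ᶠ i in l, ∀ t, |f i t| ≤ C * (1 + |t|) ^ m

namespace TendstoPolyBounded

variable {ι : Type*} {l : Filter ι} {f g : ι → ℝ → ℝ} {f₀ g₀ : ℝ → ℝ}

theorem const_left {a : ι → ℝ} {a₀ : ℝ} (h : Tendsto a l (𝓝 a₀)) :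
    TendstoPolyBounded l (fun i _ => a i) fun _ => a₀ where
  continuous _ := continuous_const
  tendsto _ := h
  bound := ⟨|a₀| + 1, by positivity, 0, by
    filter_upwards [h.abs.eventually (gt_mem_nhds (lt_add_one |a₀|))] with i hi t
    simpa using hi.le⟩

theorem pow_id (n : ℕ) : TendstoPolyBounded l (fun _ t => t ^ n) fun t => t ^ n where
  continuous _ := by fun_prop
  tendsto _ := tendsto_const_nhds
  bound := ⟨1, zero_le_one, n, Eventually.of_forall fun _ t => by
    simpa using abs_pow_le_one_add_abs_pow t n⟩

theorem mul (hf : TendstoPolyBounded l f f₀) (hg : TendstoPolyBounded l g g₀) :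
    TendstoPolyBounded l (fun i t => f i t * g i t) fun t => f₀ t * g₀ t where
  continuous i := (hf.continuous i).mul (hg.continuous i)
  tendsto t := (hf.tendsto t).mul (hg.tendsto t)
  bound := by
    obtain ⟨C, hC, m, h⟩ := hf.bound
    obtain ⟨D, hD, k, h'⟩ := hg.bound
    refine ⟨C * D, mul_nonneg hC hD, m + k, ?_⟩
    filter_upwards [h, h'] with i hi hi' t
    rw [abs_mul]
    calc |f i t| * |g i t| ≤ (C * (1 + |t|) ^ m) * (D * (1 + |t|) ^ k) :=
          mul_le_mul (hi t) (hi' t) (abs_nonneg _) (by positivity)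
      _ = _ := by rw [pow_add]; ring

theorem add (hf : TendstoPolyBounded l f f₀) (hg : TendstoPolyBounded l g g₀) :
    TendstoPolyBounded l (fun i t => f i t + g i t) fun t => f₀ t + g₀ t where
  continuous i := (hf.continuous i).add (hg.continuous i)
  tendsto t := (hf.tendsto t).add (hg.tendsto t)
  bound := by
    obtain ⟨C, hC, m, h⟩ := hf.bound
    obtain ⟨D, hD, k, h'⟩ := hg.bound
    refine ⟨C + D, add_nonneg hC hD, max m k, ?_⟩
    filter_upwards [h, h'] with i hi hi' t
    have h1 : 1 ≤ 1 + |t| := by linarith [abs_nonneg t]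
    refine (abs_add_le _ _).trans ?_
    rw [add_mul]
    exact add_le_add
      ((hi t).trans (mul_le_mul_of_nonneg_left (pow_le_pow_right₀ h1 (le_max_left _ _)) hC))
      ((hi' t).trans (mul_le_mul_of_nonneg_left (pow_le_pow_right₀ h1 (le_max_right _ _)) hD))

theorem neg (hf : TendstoPolyBounded l f f₀) :
    TendstoPolyBounded l (fun i t => -f i t) fun t => -f₀ t where
  continuous i := (hf.continuous i).neg
  tendsto t := (hf.tendsto t).neg
  bound := by simpa only [abs_neg] using hf.bound

theorem sum {κ : Type*} (s : Finset κ) {F : κ → ι → ℝ → ℝ} {F₀ : κ → ℝ → ℝ}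
    (h : ∀ k ∈ s, TendstoPolyBounded l (F k) (F₀ k)) :
    TendstoPolyBounded l (fun i t => ∑ k ∈ s, F k i t) fun t => ∑ k ∈ s, F₀ k t := by
  classical
  induction s using Finset.induction_on with
  | empty => simpa using const_left (tendsto_const_nhds (x := (0 : ℝ)))
  | insert a s ha ih =>
    simp only [Finset.sum_insert ha]
    exact (h a (by simp)).add (ih fun k hk => h k (by simp [hk]))

end TendstoPolyBounded

/-- Pointwise convergence of densities with a uniform exponential bound. -/
structure TendstoExpBounded {ι : Type*} (l : Filter ι) (G : ι → ℝ → ℝ) (g : ℝ → ℝ) : Prop where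
  measurable : ∀ i, Measurable (G i)
  nonneg : ∀ i t, 0 ≤ G i t
  measurable_lim : Measurable g
  nonneg_lim : ∀ t, 0 ≤ g t
  tendsto : ∀ t, Tendsto (fun i => G i t) l (𝓝 (g t))
  bound : ∃ B, 0 ≤ B ∧ ∀ᶠ i in l, ∀ t, G i t ≤ B * Real.exp (-|t| / 2)

namespace TendstoExpBounded

variable {ι : Type*} {l : Filter ι} [l.IsCountablyGenerated] {G : ι → ℝ → ℝ} {g : ℝ → ℝ}

theorem tendsto_setIntegral (hG : TendstoExpBounded l G g) {f : ι → ℝ → ℝ} {f₀ : ℝ → ℝ}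
    (hf : TendstoPolyBounded l f f₀) {S : ι → Set ℝ} {S₀ : Set ℝ}
    (hS : ∀ i, MeasurableSet (S i)) (hS₀ : MeasurableSet S₀)
    (hlim : ∀ᵐ t, ∀ᶠ i in l, (t ∈ S i ↔ t ∈ S₀)) :
    Tendsto (fun i => ∫ t in S i, f i t ∂densityMeasure (G i)) l
      (𝓝 (∫ t in S₀, f₀ t ∂densityMeasure g)) := by
  simp_rw [← integral_indicator (hS _), ← integral_indicator hS₀]
  simp_rw [integral_densityMeasure (hG.measurable _) (hG.nonneg _)]
  rw [integral_densityMeasure hG.measurable_lim hG.nonneg_lim]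
  obtain ⟨B, hB, hGB⟩ := hG.bound
  obtain ⟨C, hC, m, hfC⟩ := hf.bound
  refine tendsto_integral_filter_of_dominated_convergence
    (fun t => B * C * ((1 + |t|) ^ m * Real.exp (-|t| / 2))) ?_ ?_
    ((integrable_one_add_abs_pow_mul_exp m).const_mul _) ?_
  · exact Eventually.of_forall fun i =>
      ((hG.measurable i).mul ((hf.continuous i).measurable.indicator (hS i))).aestronglyMeasurable
  · filter_upwards [hGB, hfC] with i hi hi'
    refine Eventually.of_forall fun t => ?_
    rw [norm_mul, Real.norm_of_nonneg (hG.nonneg i t)]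
    calc G i t * ‖(S i).indicator (f i) t‖
        ≤ (B * Real.exp (-|t| / 2)) * (C * (1 + |t|) ^ m) :=
          mul_le_mul (hi t) ((norm_indicator_le_norm_self _ _).trans (hi' t)) (norm_nonneg _)
            (by positivity)
      _ = _ := by ring
  · filter_upwards [hlim] with t ht
    refine (hG.tendsto t).mul ?_
    by_cases h : t ∈ S₀
    · rw [Set.indicator_of_mem h]
      refine (hf.tendsto t).congr' ?_
      filter_upwards [ht] with i hi
      rw [Set.indicator_of_mem (hi.2 h)]
    · rw [Set.indicator_of_notMem h]
      refine tendsto_const_nhds.congr' ?_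
      filter_upwards [ht] with i hi
      rw [Set.indicator_of_notMem (mt hi.1 h)]

theorem tendsto_integral (hG : TendstoExpBounded l G g) {f : ι → ℝ → ℝ} {f₀ : ℝ → ℝ}
    (hf : TendstoPolyBounded l f f₀) :
    Tendsto (fun i => ∫ t, f i t ∂densityMeasure (G i)) l (𝓝 (∫ t, f₀ t ∂densityMeasure g)) := by
  simpa using hG.tendsto_setIntegral hf (S := fun _ => Set.univ) (fun _ => MeasurableSet.univ)
    MeasurableSet.univ (by simp)

theorem tendsto_monicOrthoPoly (hG : TendstoExpBounded l G g) (hW : IsPolyWeight (densityMeasure g))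
    (n : ℕ) : TendstoPolyBounded l (fun i t => (monicOrthoPoly (densityMeasure (G i)) n).eval t)
      fun t => (monicOrthoPoly (densityMeasure g) n).eval t := by
  induction n using Nat.strong_induction_on with
  | _ n ih =>
    have h : ∀ (W : Measure ℝ) (t : ℝ), (monicOrthoPoly W n).eval t = t ^ n +
        -∑ k : Fin n, ((∫ s, s ^ n * (monicOrthoPoly W k).eval s ∂W) /
          ∫ s, (monicOrthoPoly W k).eval s ^ 2 ∂W) * (monicOrthoPoly W k).eval t := by
      intro W t
      rw [monicOrthoPoly_eq W n, eval_sub, eval_finsetSum, sub_eq_add_neg]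
      simp
    simp_rw [h]
    refine (TendstoPolyBounded.pow_id n).add (TendstoPolyBounded.sum _ fun k _ => ?_).neg
    refine (TendstoPolyBounded.const_left (Tendsto.div ?_ ?_ ?_)).mul (ih k k.2)
    · exact hG.tendsto_integral ((TendstoPolyBounded.pow_id n).mul (ih k k.2))
    · simp only [sq]
      exact hG.tendsto_integral ((ih k k.2).mul (ih k k.2))
    · exact (hW.integral_monicOrthoPoly_sq_pos k).ne'

theorem tendsto_orthonormalPoly (hG : TendstoExpBounded l G g)
    (hW : IsPolyWeight (densityMeasure g)) (n : ℕ) :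
    TendstoPolyBounded l (fun i => orthonormalPoly (densityMeasure (G i)) n)
      (orthonormalPoly (densityMeasure g) n) := by
  have h := hG.tendsto_monicOrthoPoly hW n
  refine h.mul (TendstoPolyBounded.const_left (Tendsto.inv₀ (Tendsto.sqrt ?_) ?_))
  · simp only [sq]
    exact hG.tendsto_integral (h.mul h)
  · exact (Real.sqrt_pos.2 (hW.integral_monicOrthoPoly_sq_pos n)).ne'

theorem tendsto_discreteKernelOn (hG : TendstoExpBounded l G g)
    (hW : IsPolyWeight (densityMeasure g)) {S : ι → Set ℝ} {S₀ : Set ℝ}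
    (hS : ∀ i, MeasurableSet (S i)) (hS₀ : MeasurableSet S₀)
    (hlim : ∀ᵐ t, ∀ᶠ i in l, (t ∈ S i ↔ t ∈ S₀)) (x y : ℕ) :
    Tendsto (fun i => discreteKernelOn (densityMeasure (G i)) (S i) x y) l
      (𝓝 (discreteKernelOn (densityMeasure g) S₀ x y)) :=
  hG.tendsto_setIntegral ((hG.tendsto_orthonormalPoly hW x).mul (hG.tendsto_orthonormalPoly hW y))
    hS hS₀ hlim

end TendstoExpBounded

end Densities

section HermiteLaguerre

open Polynomial

theorem isPolyWeight_hermiteWeight : IsPolyWeight hermiteWeight := by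
  have hm : Measurable fun t : ℝ => Real.exp (-t ^ 2) := by fun_prop
  refine isPolyWeight_densityMeasure hm (fun t => (Real.exp_pos _).le) (a := 0)
    (fun t _ => Real.exp_pos _)
    (integrable_mul_eval_of_le_exp hm (fun t => (Real.exp_pos _).le) (B := Real.exp 1) fun t => ?_)
  rw [← Real.exp_add, Real.exp_le_exp]
  nlinarith [sq_abs t, sq_nonneg (|t| - 1)]

theorem laguerreWeight_eq (β : ℝ) : laguerreWeight β =
    densityMeasure ((Set.Ioi 0).indicator fun t => t ^ (β - 1) * Real.exp (-t)) := by
  rw [laguerreWeight, ← withDensity_indicator measurableSet_Ioi, densityMeasure]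
  congr 1
  ext t
  by_cases ht : t ∈ Set.Ioi (0 : ℝ)
  · simp only [Set.indicator_of_mem ht]
  · simp only [Set.indicator_of_notMem ht, ENNReal.ofReal_zero]

theorem measurable_laguerre_density (β : ℝ) :
    Measurable ((Set.Ioi 0).indicator fun t : ℝ => t ^ (β - 1) * Real.exp (-t)) :=
  Measurable.indicator (by fun_prop) measurableSet_Ioi

theorem laguerre_density_nonneg (β t : ℝ) :
    0 ≤ (Set.Ioi 0).indicator (fun t : ℝ => t ^ (β - 1) * Real.exp (-t)) t :=
  Set.indicator_nonneg
    (fun _ ht => mul_nonneg (Real.rpow_nonneg (le_of_lt ht) _) (Real.exp_pos _).le) t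

theorem isPolyWeight_laguerreWeight {β : ℝ} (hβ : 0 < β) : IsPolyWeight (laguerreWeight β) := by
  rw [laguerreWeight_eq]
  refine isPolyWeight_densityMeasure (measurable_laguerre_density β) (laguerre_density_nonneg β)
    (a := 0) (fun t ht => ?_) fun p => ?_
  · rw [Set.indicator_of_mem (Set.mem_Ioi.2 ht)]
    exact mul_pos (Real.rpow_pos_of_pos ht _) (Real.exp_pos _)
  · simp_rw [eval_eq_sum_range, Finset.mul_sum]
    refine integrable_finsetSum _ fun i _ => ?_
    have h := (Real.GammaIntegral_convergent (s := β + i) (by positivity)).const_mul (p.coeff i)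
    rw [← IntegrableOn, ← integrable_indicator_iff measurableSet_Ioi] at h
    refine h.congr (Eventually.of_forall fun t => ?_)
    by_cases ht : t ∈ Set.Ioi (0 : ℝ)
    · simp only [Set.indicator_of_mem ht]
      have : t ^ (β + i - 1) = t ^ (β - 1) * t ^ i := by
        rw [← Real.rpow_natCast, ← Real.rpow_add ht]
        congr 1; ring
      rw [this]; ring
    · simp only [Set.indicator_of_notMem ht, zero_mul]

/-- The Laguerre density in the variable `s` with `t = β + √(2β) s`, normalized to the value `1`
at `s = 0`. -/
noncomputable def scaledLaguerreDensity (β s : ℝ) : ℝ :=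
  if -1 < √(2 * β) / β * s then
    Real.exp ((β - 1) * Real.log (1 + √(2 * β) / β * s) - β * (√(2 * β) / β * s)) else 0

theorem scaledLaguerreDensity_nonneg (β s : ℝ) : 0 ≤ scaledLaguerreDensity β s := by
  unfold scaledLaguerreDensity
  split_ifs
  exacts [(Real.exp_pos _).le, le_rfl]

theorem measurable_scaledLaguerreDensity (β : ℝ) : Measurable (scaledLaguerreDensity β) :=
  Measurable.ite (measurableSet_lt measurable_const (by fun_prop)) (by fun_prop) measurable_const

theorem scaledLaguerreDensity_le {β : ℝ} (hβ : 2 ≤ β) (s : ℝ) :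
    scaledLaguerreDensity β s ≤ Real.exp 2 * Real.exp (-|s| / 2) := by
  rw [scaledLaguerreDensity]
  have hβ0 : 0 < β := by linarith
  have hu2 : β * (√(2 * β) / β * s) ^ 2 = 2 * s ^ 2 := by
    rw [mul_pow, div_pow, Real.sq_sqrt (by positivity)]
    field_simp
  generalize √(2 * β) / β * s = u at hu2 ⊢
  split_ifs with hu
  swap
  · positivity
  rw [← Real.exp_add, Real.exp_le_exp]
  have h1u : 0 < 1 + u := by linarith
  have hlog : Real.log (1 + u) ≤ 2 * (√(1 + u) - 1) := by
    have := Real.log_le_sub_one_of_pos (Real.sqrt_pos.2 h1u)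
    rw [Real.log_sqrt h1u.le] at this
    linarith
  have hv : √(1 + u) ^ 2 = 1 + u := Real.sq_sqrt h1u.le
  have hv0 : 0 ≤ √(1 + u) := Real.sqrt_nonneg _
  generalize √(1 + u) = v at hlog hv hv0
  have hus : |u| ≤ |s| := by
    rw [← sq_le_sq]
    nlinarith [sq_nonneg u]
  have hv1 : v ≤ 1 + |u| / 2 := by
    refine abs_le_of_sq_le_sq' ?_ (by positivity) |>.2
    nlinarith [le_abs_self u, sq_nonneg |u|]
  have hvp : (v + 1) ^ 2 ≤ 4 + 2 * |s| := by nlinarith [le_abs_self u]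
  have huv : u ^ 2 = (v - 1) ^ 2 * (v + 1) ^ 2 := by
    have : u = v ^ 2 - 1 := by linarith
    rw [this]; ring
  have h1 : s ^ 2 ≤ (β - 1) * (v - 1) ^ 2 * (4 + 2 * |s|) := by
    have h2 : s ^ 2 ≤ (β - 1) * u ^ 2 := by nlinarith [sq_nonneg u]
    rw [huv] at h2
    have h3 : (β - 1) * (v - 1) ^ 2 * (v + 1) ^ 2 ≤ (β - 1) * (v - 1) ^ 2 * (4 + 2 * |s|) :=
      mul_le_mul_of_nonneg_left hvp (mul_nonneg (by linarith) (sq_nonneg _))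
    linarith
  have h4 : (|s| - 2) / 2 ≤ (β - 1) * (v - 1) ^ 2 := by
    have hp : 0 < 4 + 2 * |s| := by positivity
    refine le_of_mul_le_mul_right (le_trans ?_ h1) hp
    nlinarith [sq_abs s]
  have h5 : (β - 1) * (Real.log (1 + u) - u) ≤ (β - 1) * -(v - 1) ^ 2 :=
    mul_le_mul_of_nonneg_left (by nlinarith) (by linarith)
  nlinarith

theorem isPolyWeight_scaledLaguerreDensity {β : ℝ} (hβ : 2 ≤ β) :
    IsPolyWeight (densityMeasure (scaledLaguerreDensity β)) := by
  refine isPolyWeight_densityMeasure (measurable_scaledLaguerreDensity β)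
    (scaledLaguerreDensity_nonneg β) (a := 0) (fun s hs => ?_)
    (integrable_mul_eval_of_le_exp (measurable_scaledLaguerreDensity β)
      (scaledLaguerreDensity_nonneg β) (scaledLaguerreDensity_le hβ))
  have : 0 ≤ √(2 * β) / β * s := by positivity
  rw [scaledLaguerreDensity, if_pos (by linarith)]
  exact Real.exp_pos _

theorem tendsto_scaledLaguerreDensity (s : ℝ) :
    Tendsto (fun β => scaledLaguerreDensity β s) atTop (𝓝 (Real.exp (-s ^ 2))) := by
  have hu : Tendsto (fun β : ℝ => √(2 * β) / β * s) atTop (𝓝 0) := by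
    have h1 : Tendsto (fun β : ℝ => √2 * (√β)⁻¹ * s) atTop (𝓝 (√2 * 0 * s)) :=
      ((tendsto_inv_atTop_zero.comp Real.tendsto_sqrt_atTop).const_mul _).mul_const _
    rw [mul_zero, zero_mul] at h1
    refine h1.congr' ?_
    filter_upwards [eventually_gt_atTop 0] with β hβ
    have h2 : √β ≠ 0 := (Real.sqrt_pos.2 hβ).ne'
    have h3 : β = √β * √β := (Real.mul_self_sqrt hβ.le).symm
    rw [Real.sqrt_mul (by norm_num)]
    nth_rewrite 3 [h3]
    field_simp
  have hlog : Tendsto (fun β : ℝ => Real.log (1 + √(2 * β) / β * s)) atTop (𝓝 0) := by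
    have : Tendsto (fun x : ℝ => Real.log (1 + x)) (𝓝 0) (𝓝 (Real.log (1 + 0))) :=
      (ContinuousAt.log (by fun_prop) (by norm_num)).tendsto
    rw [add_zero, Real.log_one] at this
    exact this.comp hu
  have hrem : Tendsto (fun β : ℝ => β * (Real.log (1 + √(2 * β) / β * s) - √(2 * β) / β * s) +
      s ^ 2) atTop (𝓝 0) := by
    have hbd : Tendsto (fun β : ℝ => 2 * s ^ 2 * |√(2 * β) / β * s| / (1 - |√(2 * β) / β * s|))
        atTop (𝓝 (2 * s ^ 2 * |0| / (1 - |0|))) :=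
      (hu.abs.const_mul _).div (hu.abs.const_sub 1) (by norm_num)
    rw [abs_zero, mul_zero, zero_div] at hbd
    refine squeeze_zero_norm' ?_ hbd
    have hlt : ∀ᶠ β : ℝ in atTop, |√(2 * β) / β * s| < 1 := by
      have := hu.abs
      rw [abs_zero] at this
      exact this.eventually (gt_mem_nhds zero_lt_one)
    filter_upwards [hlt, eventually_gt_atTop 0] with β h1 hβ
    have hu2 : β * (√(2 * β) / β * s) ^ 2 = 2 * s ^ 2 := by
      rw [mul_pow, div_pow, Real.sq_sqrt (by positivity)]
      field_simp
    generalize √(2 * β) / β * s = u at h1 hu2 ⊢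
    have h2 := Real.abs_log_sub_add_sum_range_le (x := -u) (by rwa [abs_neg]) 2
    rw [abs_neg, Finset.sum_range_succ, Finset.sum_range_one] at h2
    have h3 : β * (Real.log (1 + u) - u) + s ^ 2 =
        β * ((-u) ^ (0 + 1) / ((0 : ℕ) + 1) + (-u) ^ (1 + 1) / ((1 : ℕ) + 1) +
          Real.log (1 - -u)) := by
      rw [sub_neg_eq_add]
      push_cast
      linear_combination -hu2 / 2
    rw [h3, norm_mul, Real.norm_of_nonneg hβ.le, Real.norm_eq_abs]
    refine (mul_le_mul_of_nonneg_left h2 hβ.le).trans (le_of_eq ?_)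
    rw [← hu2, ← sq_abs u]
    ring
  have hexp : Tendsto (fun β : ℝ => (β * (Real.log (1 + √(2 * β) / β * s) - √(2 * β) / β * s) +
      s ^ 2) - Real.log (1 + √(2 * β) / β * s) - s ^ 2) atTop (𝓝 (0 - 0 - s ^ 2)) :=
    (hrem.sub hlog).sub_const _
  rw [sub_zero, zero_sub] at hexp
  refine ((Real.continuous_exp.tendsto _).comp hexp).congr' ?_
  filter_upwards [hu.eventually (lt_mem_nhds (by norm_num : (-1 : ℝ) < 0))] with β hβ
  rw [scaledLaguerreDensity, if_pos hβ, Function.comp_apply]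
  congr 1
  ring

theorem tendstoExpBounded_scaledLaguerreDensity (l : Filter ℝ) :
    TendstoExpBounded (atTop ×ˢ l) (fun q : ℝ × ℝ => scaledLaguerreDensity q.1)
      fun s => Real.exp (-s ^ 2) where
  measurable q := measurable_scaledLaguerreDensity q.1
  nonneg q := scaledLaguerreDensity_nonneg q.1
  measurable_lim := by fun_prop
  nonneg_lim s := (Real.exp_pos _).le
  tendsto s := (tendsto_scaledLaguerreDensity s).comp tendsto_fst
  bound := ⟨Real.exp 2, (Real.exp_pos _).le, by
    filter_upwards [tendsto_fst.eventually (eventually_ge_atTop 2)] with q hq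
    exact scaledLaguerreDensity_le hq⟩

theorem integral_laguerreWeight {β : ℝ} (hβ : 0 < β) (f : ℝ → ℝ) :
    ∫ t, f t ∂laguerreWeight β = (√(2 * β) * (β ^ (β - 1) * Real.exp (-β))) *
      ∫ s, f (√(2 * β) * s + β) ∂densityMeasure (scaledLaguerreDensity β) := by
  rw [laguerreWeight_eq,
    integral_densityMeasure (measurable_laguerre_density β) (laguerre_density_nonneg β),
    integral_densityMeasure (measurable_scaledLaguerreDensity β) (scaledLaguerreDensity_nonneg β)]
  have ha : 0 < √(2 * β) := Real.sqrt_pos.2 (by linarith)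
  have hsub : ∀ F : ℝ → ℝ, ∫ t, F t = √(2 * β) * ∫ s, F (√(2 * β) * s + β) := by
    intro F
    rw [Measure.integral_comp_mul_left (fun s => F (s + β)), integral_add_right_eq_self,
      abs_of_pos (inv_pos.2 ha), smul_eq_mul, mul_inv_cancel_left₀ ha.ne']
  rw [hsub, mul_assoc, ← integral_const_mul (β ^ (β - 1) * Real.exp (-β))]
  congr 2
  ext s
  have hs : √(2 * β) * s + β = β * (1 + √(2 * β) / β * s) := by
    field_simp
    ring
  rw [scaledLaguerreDensity]
  generalize √(2 * β) / β * s = u at hs ⊢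
  split_ifs with hu
  · have h1u : 0 < 1 + u := by linarith
    rw [hs, Set.indicator_of_mem (Set.mem_Ioi.2 (mul_pos hβ h1u)), Real.mul_rpow hβ.le h1u.le,
      Real.rpow_def_of_pos h1u, Real.exp_sub, mul_add, mul_one, neg_add, Real.exp_add,
      Real.exp_neg (β * u), mul_comm (Real.log (1 + u))]
    ring
  · rw [Set.indicator_of_notMem]
    · ring
    · rw [hs, Set.mem_Ioi, not_lt]
      exact mul_nonpos_of_nonneg_of_nonpos hβ.le (by linarith)

theorem discreteKernelOn_laguerreWeight {β : ℝ} (hβ : 2 ≤ β) {S : Set ℝ} (hS : MeasurableSet S)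
    (x y : ℕ) : discreteKernelOn (laguerreWeight β) S x y =
      discreteKernelOn (densityMeasure (scaledLaguerreDensity β))
        ((fun s => √(2 * β) * s + β) ⁻¹' S) x y := by
  have hβ0 : 0 < β := by linarith
  have ha : 0 < √(2 * β) := Real.sqrt_pos.2 (by linarith)
  exact discreteKernelOn_affine (isPolyWeight_laguerreWeight hβ0)
    (isPolyWeight_scaledLaguerreDensity hβ) ha
    (mul_pos ha (mul_pos (Real.rpow_pos_of_pos hβ0 _) (Real.exp_pos _)))
    (integral_laguerreWeight hβ0) hS x y

/-- In the scaling of the variable by which the Laguerre weight becomes Gaussian, the discrete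
Laguerre kernels converge to the discrete Hermite ones. -/
theorem tendsto_discreteKernelOn_laguerreWeight {ι : Type*} {l : Filter ι} {β ρ : ι → ℝ} {r : ℝ}
    (hβ : Tendsto β l atTop) (hρ : Tendsto ρ l (𝓝 r)) {T : ι → Set ℝ} {S : ℝ → Set ℝ}
    (hT : ∀ i, MeasurableSet (T i)) (hS : ∀ a, MeasurableSet (S a))
    (hTS : ∀ᶠ i in l, (fun s => √(2 * β i) * s + β i) ⁻¹' T i = S (ρ i))
    (hlim : ∀ t, t ≠ r → ∀ᶠ a in 𝓝 r, (t ∈ S a ↔ t ∈ S r)) (x y : ℕ) :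
    Tendsto (fun i => discreteKernelOn (laguerreWeight (β i)) (T i) x y) l
      (𝓝 (discreteKernelOn hermiteWeight (S r) x y)) := by
  have h := (tendstoExpBounded_scaledLaguerreDensity (𝓝 r)).tendsto_discreteKernelOn
    isPolyWeight_hermiteWeight (S := fun q => S q.2) (fun q => hS q.2) (hS r)
    (by
      have h0 : ∀ᵐ t : ℝ, t ≠ r := by simp [ae_iff]
      filter_upwards [h0] with t ht
      exact tendsto_snd.eventually (hlim t ht)) x y
  refine (h.comp (hβ.prodMk hρ)).congr' ?_
  filter_upwards [hTS, hβ.eventually (eventually_ge_atTop 2)] with i hi hβi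
  rw [discreteKernelOn_laguerreWeight hβi (hT i), hi, Function.comp_apply]

end HermiteLaguerre

/-- The ensembles `DL^±(s; b)` (`s, b > 0`) and `DH^±(s)` are well defined, i.e. there is exactly one
determinantal measure with the respective kernel; and if `β → +∞` and `r'` varies so that
`(β - r') / √(2β) → -r`, then `DL^±(r'; β) → DH^±(r)` weakly. -/
theorem mainTheorem6 :
    (∀ s b : ℝ, 0 < s → 0 < b →
      (∃! P, IsDeterminantal P (discreteKernelPlus (laguerreWeight b) s)) ∧
      (∃! P, IsDeterminantal P (discreteKernelMinus (laguerreWeight b) s))) ∧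
    (∀ s : ℝ,
      (∃! P, IsDeterminantal P (discreteKernelPlus hermiteWeight s)) ∧
      (∃! P, IsDeterminantal P (discreteKernelMinus hermiteWeight s))) ∧
    (∀ (r : ℝ) {ι : Type*} (l : Filter ι) (β r' : ι → ℝ),
      Tendsto β l atTop →
      Tendsto (fun i => (β i - r' i) / √(2 * β i)) l (𝓝 (-r)) →
      Tendsto (fun i => DLplus (r' i) (β i)) l (𝓝 (DHplus r)) ∧
      Tendsto (fun i => DLminus (r' i) (β i)) l (𝓝 (DHminus r))) := by
  refine ⟨fun s b _ hb => ⟨?_, ?_⟩, fun s => ⟨?_, ?_⟩, ?_⟩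
  · exact (isPolyWeight_laguerreWeight hb).existsUnique_isDeterminantal measurableSet_Ioi
  · exact (isPolyWeight_laguerreWeight hb).existsUnique_isDeterminantal measurableSet_Iio
  · exact isPolyWeight_hermiteWeight.existsUnique_isDeterminantal measurableSet_Ioi
  · exact isPolyWeight_hermiteWeight.existsUnique_isDeterminantal measurableSet_Iio
  intro r ι l β r' hβ hr
  have hρ : Tendsto (fun i => (r' i - β i) / √(2 * β i)) l (𝓝 r) := by
    have := hr.neg
    rw [neg_neg] at this
    refine this.congr fun i => ?_
    rw [← neg_div, neg_sub]
  have hpos : ∀ᶠ i in l, 0 < β i := hβ.eventually (eventually_gt_atTop 0)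
  constructor
  · refine IsDeterminantal.tendsto
      (K := fun i => discreteKernelOn (laguerreWeight (β i)) (Set.Ioi (r' i)))
      (L := discreteKernelOn hermiteWeight (Set.Ioi r)) ?_ ?_ ?_
    · filter_upwards [hpos] with i hi
      exact isDeterminantal_determinantalMeasure
        ((isPolyWeight_laguerreWeight hi).existsUnique_isDeterminantal measurableSet_Ioi).exists
    · exact isDeterminantal_determinantalMeasure
        (isPolyWeight_hermiteWeight.existsUnique_isDeterminantal measurableSet_Ioi).exists
    · refine tendsto_discreteKernelOn_laguerreWeight hβ hρ (S := Set.Ioi)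
        (fun _ => measurableSet_Ioi) (fun _ => measurableSet_Ioi) ?_ ?_
      · filter_upwards [hpos] with i hi
        ext s
        have ha : 0 < √(2 * β i) := Real.sqrt_pos.2 (by linarith)
        rw [Set.mem_preimage, Set.mem_Ioi, Set.mem_Ioi, div_lt_iff₀ ha, sub_lt_iff_lt_add,
          mul_comm]
      · intro t ht
        rcases lt_or_gt_of_ne ht with h | h
        · filter_upwards [lt_mem_nhds h] with a ha
          simp [ha.not_gt, h.not_gt]
        · filter_upwards [gt_mem_nhds h] with a ha
          simp [ha, h]
  · refine IsDeterminantal.tendsto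
      (K := fun i => discreteKernelOn (laguerreWeight (β i)) (Set.Iio (r' i)))
      (L := discreteKernelOn hermiteWeight (Set.Iio r)) ?_ ?_ ?_
    · filter_upwards [hpos] with i hi
      exact isDeterminantal_determinantalMeasure
        ((isPolyWeight_laguerreWeight hi).existsUnique_isDeterminantal measurableSet_Iio).exists
    · exact isDeterminantal_determinantalMeasure
        (isPolyWeight_hermiteWeight.existsUnique_isDeterminantal measurableSet_Iio).exists
    · refine tendsto_discreteKernelOn_laguerreWeight hβ hρ (S := Set.Iio)
        (fun _ => measurableSet_Iio) (fun _ => measurableSet_Iio) ?_ ?_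
      · filter_upwards [hpos] with i hi
        ext s
        have ha : 0 < √(2 * β i) := Real.sqrt_pos.2 (by linarith)
        rw [Set.mem_preimage, Set.mem_Iio, Set.mem_Iio, lt_div_iff₀ ha, lt_sub_iff_add_lt,
          mul_comm]
      · intro t ht
        rcases lt_or_gt_of_ne ht with h | h
        · filter_upwards [lt_mem_nhds h] with a ha
          simp [ha, h]
        · filter_upwards [gt_mem_nhds h] with a ha
          simp [ha.not_gt, h.not_gt]
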